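/- Entropies and logarithms are to base $2$. Let $N\ge 1$, $\mathcal N=\{1,\dots,N\}$, let $\mathbb F_q$ be a finite field, and let $h:2^{\mathcal N}\to\mathbb R$ with $h(\emptyset)=0$. **Networks and codes.** In a finite directed acyclic graph with sessions $s$, each originating at one node and required by a set of nodes, a network code consists of finite nonempty alphabets $\mathcal U_f$ for all sessions and edges $f$ and, for each edge $e$, a local function giving the symbol on $e$ from the symbols of the sessions originating at, and of the edges entering, the tail of $e$. The source symbols are independent and uniform on their alphabets. The code is zero-error if each node that requires session $s$ can recover the symbol of $s$ from the symbols available at that node. It is linear over $\mathbb F_q$ if all alphabets are $\mathbb F_q$-vector spaces and all local functions are $\mathbb F_q$-linear. It is an abelian group network code if its source and edge random variables are, jointly and up to one-to-one relabelling of the values of each variable, those constructed from a finite abelian group $G$ and subgroups $G_f$: the variable with index $f$ is the coset of $G_f$ containing a uniformly distributed element of $G$. A rate-capacity tuple $(\lambda,\omega)$ is admissible by codes of a given class if some zero-error code of the class has $\log|\mathcal U_s|\ge\lambda_s$ for all sessions $s$ and $\log|\mathcal U_e|\le\omega_e$ for all edges $e$. **The network $G^\dagger$ and connection requirement $M^\dagger$.**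 There is one session $S_{[\alpha]}$, with its own source node, for each $\emptyset\ne\alpha\subseteq\mathcal N$. From the source node of $S_{[\mathcal N]}$ there are $N$ edges carrying symbols $V_1,\dots,V_N$, each to a node from which copies of $V_j$ are distributed. * Type 0 (for each $\emptyset\neq\alpha\subseteq\mathcal N$): an edge $W$ from the source of $S_{[\alpha]}$ to a receiver requiring $S_{[\alpha]}$. * Type 1 (for each $\emptyset\neq\alpha\subseteq\mathcal N$): a receiver requiring $S_{[\mathcal N]}$, with an edge $W$ from the source of $S_{[\mathcal N]}$ and an edge $W'$ from an intermediate node that is fed with copies of $V_j$, $j\in\alpha$. * Type 2 (for each $\emptyset\neq\alpha\subsetneq\mathcal N$ and $i\in\mathcal N\setminus\alpha$): a node fed with copies of $V_j$, $j\in\alpha$, sends $W^{**}$, which is distributed to two nodes. One of them is also fed with $S_{[\alpha]}$ and sends $W$, which is distributed to an upper and a lower receiver. The other is also fed with a copy of $V_i$ and sends $W''$ to a node that is fed with a second copy of $V_i$ and sends $W^*$ to the lower receiver. The upper receiver is also fed with $S_{[\alpha]}$ and with an edge $W'$ from the source of $S_{[\mathcal N]}$, and requires $S_{[\mathcal N]}$;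 the lower receiver requires $S_{[\alpha]}$. **The tuple $T(h)$.** The rate of $S_{[\alpha]}$ is $h(\alpha)$. The capacities are: $h(\{j\})$ for $V_j$; $h(\alpha)$ for $W$ in type 0; $h(\mathcal N)-h(\alpha)$ for $W$ and $h(\alpha)$ for $W'$ in type 1; $h(\alpha)$ for $W$ and for $W^*$, $h(\mathcal N)-h(\alpha)$ for $W'$ and $h(\alpha\cup\{i\})-h(\{i\})$ for $W''$ in type 2. The edge $W^{**}$ has any capacity in $[h(\alpha),\infty]$. All remaining edges, which only distribute copies, have any capacities in $[\sum_{\beta}h(\beta),\infty]$. **Theorem.** For every such choice of the free capacities, the following hold. 1. $T(h)$ is admissible on $G^\dagger, M^\dagger$ by linear network codes over $\mathbb F_q$ if and only if $h$ is linear group characterizable over $\mathbb F_q$, i.e. there are a finite $\mathbb F_q$-vector space $\mathbf V$ and subspaces $\mathbf V_1,\dots,\mathbf V_N$ such that, for a uniformly distributed $U\in\mathbf V$, $h(\alpha)$ is the joint entropy of the cosets $(U+\mathbf V_i)_{i\in\alpha}$ for all $\alpha\subseteq\mathcal N$. 2. If $T(h)$ is admissible on $G^\dagger, M^\dagger$ by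 abelian group network codes, then $h$ is abelian group characterizable, i.e. the same holds with some finite abelian group and subgroups in place of $\mathbf V$ and $\mathbf V_i$. -/

import Mathlib

universe u v

noncomputable section

/-! ### Discrete random variables and entropy (in bits) -/

/-- The uniform distribution on a finite nonempty type. -/
def uniformLaw (Ω : Type u) [Finite Ω] [Nonempty Ω] : PMF Ω :=
  letI := Fintype.ofFinite Ω
  PMF.uniformOfFintype Ω

/-- Shannon entropy, to base 2, of a distribution on a finite type. -/
def shannonEntropy {A : Type u} (p : PMF A) : ℝ :=
  ∑' a, -((p a).toReal * Real.logb 2 (p a).toReal)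

/-- The entropy function of a family of random variables `(U i)` with joint law `P`: it sends
a set `α` of indices to the joint entropy of `(U i : i ∈ α)`. -/
def entropyFunction {ι : Type v} {A : ι → Type u} (P : PMF (∀ i, A i)) (α : Finset ι) : ℝ :=
  shannonEntropy (P.map fun x => fun i : {i // i ∈ α} => x i)

/-- Two families of random variables with joint laws `P` and `Q` are equivalent if, for each
index `i`, the support of the `i`-th variable of the one can be mapped one-to-one onto the support
of the `i`-th variable of the other such that the joint probabilities agree. -/
def EquivalentLaws {ι : Type v} {A B : ι → Type u} (P : PMF (∀ i, A i)) (Q : PMF (∀ i, B i)) :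
    Prop :=
  ∃ τ : ∀ i, (P.map fun x => x i).support ≃ (Q.map fun y => y i).support,
    ∀ x : ∀ i, (P.map fun x => x i).support,
      P (fun i => (x i : A i)) = Q (fun i => (τ i (x i) : B i))

/-! ### Random variables constructed from a finite abelian group and subgroups -/

/-- The joint law of the random variables constructed from a finite abelian group `G` and its
subgroups `K i`: the `i`-th variable is the coset of `K i` that contains a uniformly distributed
element of `G`. -/
def cosetLaw (G : Type u) [AddCommGroup G] [Finite G] {ι : Type v} (K : ι → AddSubgroup G) :
    PMF (∀ i, G ⧸ K i) :=
  (uniformLaw G).map fun g i => (g : G ⧸ K i)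

/-- `h` is the entropy function of random variables constructed from a finite abelian group and
its subgroups. -/
def AbelianGroupCharacterizable {ι : Type v} (h : Finset ι → ℝ) : Prop :=
  ∃ (G : Type u) (_ : AddCommGroup G) (_ : Finite G) (K : ι → AddSubgroup G),
    h = entropyFunction (cosetLaw G K)

/-- `h` is the entropy function of random variables constructed from a finite vector space over
`F` and its subspaces. -/
def LinearGroupCharacterizable (F : Type u) [Field F] {ι : Type v} (h : Finset ι → ℝ) : Prop :=
  ∃ (V : Type u) (_ : AddCommGroup V) (_ : Module F V) (_ : Finite V) (W : ι → Submodule F V),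
    h = entropyFunction (cosetLaw V fun i => (W i).toAddSubgroup)

/-! ### Networks and network codes -/

/-- A finite directed acyclic graph with node set `P` and edge set `E`. -/
structure Network (P E : Type) where
  tail : E → P
  head : E → P
  finite_nodes : Finite P
  finite_edges : Finite E
  acyclic : ∀ e, ¬ Relation.TransGen (fun e f => head e = tail f) e e

/-- A connection requirement with session set `S`: the node where each session originates, and the
set of nodes that require it. -/
structure ConnectionRequirement (S P : Type) where
  origin : S → P
  destinations : S → Set P

theorem Network.wellFounded {P E : Type} (net : Network P E) :
    WellFounded (fun e f => net.head e = net.tail f) := by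
  have := net.finite_edges
  have : Std.Irrefl (Relation.TransGen (fun e f => net.head e = net.tail f)) := ⟨net.acyclic⟩
  have h := Finite.wellFounded_of_trans_of_irrefl
    (Relation.TransGen (fun e f => net.head e = net.tail f))
  refine ⟨fun e => ?_⟩
  induction e using h.induction with
  | _ e ih => exact ⟨e, fun f hf => ih f (Relation.TransGen.single hf)⟩

variable {S P E : Type}

/-- The sources and edges whose symbols are available at the node `p`: the sessions that originate
at `p`, and the edges that enter `p`. -/
def AvailableAt (net : Network P E) (M : ConnectionRequirement S P) (p : P) : S ⊕ E → Prop
  | Sum.inl s => M.origin s = p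
  | Sum.inr f => net.head f = p

/-- A network code: finite alphabets for the sources and the edges, and for each edge `e` a local
coding function of the symbols that are available at the tail of `e`. -/
structure NetworkCode (net : Network P E) (M : ConnectionRequirement S P) where
  alphabet : S ⊕ E → Type u
  finite_alphabet : ∀ f, Finite (alphabet f)
  nonempty_alphabet : ∀ f, Nonempty (alphabet f)
  localMap : ∀ e, (∀ f : {f // AvailableAt net M (net.tail e) f}, alphabet f) →
    alphabet (Sum.inr e)

namespace NetworkCode

variable {net : Network P E} {M : ConnectionRequirement S P}

/-- The symbol sent along each edge, given the source symbols. -/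
def edgeSymbol (c : NetworkCode.{u} net M) (x : ∀ s, c.alphabet (Sum.inl s)) :
    ∀ e, c.alphabet (Sum.inr e) :=
  net.wellFounded.fix fun e ih => c.localMap e fun f =>
    match f with
    | ⟨Sum.inl s, _⟩ => x s
    | ⟨Sum.inr f, hf⟩ => ih f hf

/-- All source and edge symbols, given the source symbols. -/
def symbol (c : NetworkCode.{u} net M) (x : ∀ s, c.alphabet (Sum.inl s)) :
    ∀ f, c.alphabet f
  | Sum.inl s => x s
  | Sum.inr e => c.edgeSymbol x e

/-- The symbol on an edge is the local coding function applied to the available symbols. -/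
theorem symbol_inr (c : NetworkCode.{u} net M) (x : ∀ s, c.alphabet (Sum.inl s)) (e : E) :
    c.symbol x (Sum.inr e) = c.localMap e fun f => c.symbol x f := by
  change c.edgeSymbol x e = _
  unfold edgeSymbol
  rw [WellFounded.fix_eq]
  congr 1
  funext f
  rcases f with ⟨s | f, hf⟩ <;> rfl

/-- The joint law of all source and edge symbols when the source symbols are independent and
uniformly distributed. -/
def law [Finite S] (c : NetworkCode.{u} net M) : PMF (∀ f, c.alphabet f) :=
  haveI := c.finite_alphabet
  haveI := c.nonempty_alphabet
  (uniformLaw (∀ s, c.alphabet (Sum.inl s))).map c.symbol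

/-- Each node that requires a session can reconstruct its symbol, without error, from the symbols
that are available there. -/
def ZeroError (c : NetworkCode.{u} net M) : Prop :=
  ∀ s, ∀ p ∈ M.destinations s,
    ∃ decode : (∀ f : {f // AvailableAt net M p f}, c.alphabet f) → c.alphabet (Sum.inl s),
      ∀ x, decode (fun f => c.symbol x f) = x s

/-- The code is linear over `F`: its alphabets are vector spaces over `F`, and its local coding
functions are linear. -/
def IsLinear (F : Type u) [Field F] (c : NetworkCode.{u} net M) : Prop :=
  ∃ (_ : ∀ f, AddCommGroup (c.alphabet f)) (_ : ∀ f, Module F (c.alphabet f)),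
    ∀ e, IsLinearMap F (c.localMap e)

/-- The code is an abelian group network code: its source and edge symbols are equivalent to the
random variables constructed from a finite abelian group and subgroups of it. -/
def IsAbelianGroupCode [Finite S] (c : NetworkCode.{u} net M) : Prop :=
  ∃ (G : Type u) (_ : AddCommGroup G) (_ : Finite G) (K : S ⊕ E → AddSubgroup G),
    EquivalentLaws c.law (cosetLaw G K)

end NetworkCode

/-- The rate-capacity tuple `(rate, cap)` is admissible by codes in the class `C`. The capacity `⊤`
stands for an uncapacitated edge. The source and edge symbols of a code always satisfy
`H(U_s) = log |alphabet s|` and `H(U_e) ≤ log |alphabet e|`. -/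
def AdmissibleBy {net : Network P E} {M : ConnectionRequirement S P}
    (C : NetworkCode.{u} net M → Prop) (rate : S → ℝ) (cap : E → WithTop ℝ) : Prop :=
  ∃ c : NetworkCode.{u} net M, C c ∧ c.ZeroError ∧
    (∀ e, ((Real.logb 2 (Nat.card (c.alphabet (Sum.inr e))) : ℝ) : WithTop ℝ) ≤ cap e) ∧
    (∀ s, rate s ≤ Real.logb 2 (Nat.card (c.alphabet (Sum.inl s))))

/-! ### The network, connection requirement and rate-capacity tuple induced by a function -/

namespace Dagger

/-- The sessions are the nonempty subsets of the ground set. -/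
abbrev Session (N : ℕ) : Type := {α : Finset (Fin N) // α.Nonempty}

/-- The session that belongs to the whole ground set. -/
def full (N : ℕ) [NeZero N] : Session N :=
  ⟨Finset.univ, ⟨0, Finset.mem_univ _⟩⟩

/-- The indices `(α, i)` of the type 2 subnetworks: `α` is nonempty and `i ∉ α`. -/
abbrev Pair (N : ℕ) : Type := {t : Finset (Fin N) × Fin N // t.1.Nonempty ∧ t.2 ∉ t.1}

/-- The set `α` of the index `(α, i)`, as a session. -/
def Pair.set {N : ℕ} (t : Pair N) : Session N := ⟨t.1.1, t.2.1⟩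

/-- The element `i` of the index `(α, i)`. -/
def Pair.elt {N : ℕ} (t : Pair N) : Fin N := t.1.2

inductive Node (N : ℕ) : Type
  /-- the source of session `α` -/
  | source (α : Session N)
  /-- the node from which `V_j` is distributed -/
  | hub (j : Fin N)
  /-- type 0: the receiver -/
  | sink₀ (α : Session N)
  /-- type 1: the intermediate node -/
  | relay₁ (α : Session N)
  /-- type 1: the receiver -/
  | sink₁ (α : Session N)
  /-- type 2: the node that collects `V_α` -/
  | gather (t : Pair N)
  /-- type 2: the node from which `W**` is distributed -/
  | split (t : Pair N)
  /-- type 2: the node that combines `W**` with the source symbol of `α` into `W` -/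
  | mix (t : Pair N)
  /-- type 2: the node from which `W` is distributed -/
  | fork (t : Pair N)
  /-- type 2: the node that encodes `W**` and `V_i` into `W''` -/
  | encode (t : Pair N)
  /-- type 2: the node that maps `W''` and `V_i` to `W*` -/
  | decode (t : Pair N)
  /-- type 2: the upper receiver -/
  | upper (t : Pair N)
  /-- type 2: the lower receiver -/
  | lower (t : Pair N)
  deriving Fintype

set_option synthInstance.maxHeartbeats 400000 in
set_option synthInstance.maxSize 2000 in
inductive Edge (N : ℕ) : Type
  /-- part 1: the edge that carries `V_j` -/
  | V (j : Fin N)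
  /-- type 0: the edge `W` -/
  | W₀ (α : Session N)
  /-- type 1: the edge `W` -/
  | W₁ (α : Session N)
  /-- type 1: the edge `W'` -/
  | W₁' (α : Session N)
  /-- type 1: the incident edge that brings a copy of `V_j`, for `p = (α, j)` with `j ∈ α` -/
  | in₁ (p : {p : Session N × Fin N // p.2 ∈ p.1.1})
  /-- type 2: the edge `W` -/
  | W₂ (t : Pair N)
  /-- type 2: the edge `W'` -/
  | W₂' (t : Pair N)
  /-- type 2: the edge `W''` -/
  | W₂'' (t : Pair N)
  /-- type 2: the edge `W*` -/
  | Wstar (t : Pair N)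
  /-- type 2: the edge `W**` -/
  | Wstarstar (t : Pair N)
  /-- type 2: the incident edge that brings a copy of `V_j`, for `p = (t, j)` with `j ∈ α` -/
  | in₂ (p : {p : Pair N × Fin N // p.2 ∈ p.1.1.1})
  /-- type 2: the two incident edges that bring copies of `V_i` -/
  | sideEncode (t : Pair N)
  | sideDecode (t : Pair N)
  /-- type 2: the two edges that bring copies of the source symbol of `α` -/
  | sourceMix (t : Pair N)
  | sourceUpper (t : Pair N)
  /-- type 2: the two edges that forward copies of `W**` -/
  | splitMix (t : Pair N)
  | splitEncode (t : Pair N)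
  /-- type 2: the two edges that forward copies of `W` -/
  | forkUpper (t : Pair N)
  | forkLower (t : Pair N)
  deriving Fintype

variable {N : ℕ}

def tail [NeZero N] : Edge N → Node N
  | .V _ => .source (full N)
  | .W₀ α => .source α
  | .W₁ _ => .source (full N)
  | .W₁' α => .relay₁ α
  | .in₁ p => .hub p.1.2
  | .W₂ t => .mix t
  | .W₂' _ => .source (full N)
  | .W₂'' t => .encode t
  | .Wstar t => .decode t
  | .Wstarstar t => .gather t
  | .in₂ p => .hub p.1.2
  | .sideEncode t => .hub t.elt
  | .sideDecode t => .hub t.elt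
  | .sourceMix t => .source t.set
  | .sourceUpper t => .source t.set
  | .splitMix t => .split t
  | .splitEncode t => .split t
  | .forkUpper t => .fork t
  | .forkLower t => .fork t

def head : Edge N → Node N
  | .V j => .hub j
  | .W₀ α => .sink₀ α
  | .W₁ α => .sink₁ α
  | .W₁' α => .sink₁ α
  | .in₁ p => .relay₁ p.1.1
  | .W₂ t => .fork t
  | .W₂' t => .upper t
  | .W₂'' t => .decode t
  | .Wstar t => .lower t
  | .Wstarstar t => .split t
  | .in₂ p => .gather p.1.1
  | .sideEncode t => .encode t
  | .sideDecode t => .decode t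
  | .sourceMix t => .mix t
  | .sourceUpper t => .upper t
  | .splitMix t => .mix t
  | .splitEncode t => .encode t
  | .forkUpper t => .upper t
  | .forkLower t => .lower t

/-- A topological numbering of the nodes, used only to show that the network is acyclic. -/
def depth : Node N → ℕ
  | .source _ => 0
  | .hub _ => 1
  | .relay₁ _ => 2
  | .gather _ => 2
  | .split _ => 3
  | .mix _ => 4
  | .encode _ => 4
  | .fork _ => 5
  | .decode _ => 5
  | .sink₀ _ => 6
  | .sink₁ _ => 6
  | .upper _ => 6
  | .lower _ => 6

theorem depth_lt [NeZero N] (e : Edge N) : depth (tail e) < depth (head e) := by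
  cases e <;> simp [tail, head, depth]

/-- The network. -/
def network (N : ℕ) [NeZero N] : Network (Node N) (Edge N) where
  tail := tail
  head := head
  finite_nodes := inferInstance
  finite_edges := inferInstance
  acyclic := by
    have key : ∀ e f : Edge N, Relation.TransGen (fun e f => head e = tail f) e f →
        depth (tail e) < depth (tail f) := by
      intro e f h
      induction h with
      | single h => exact h ▸ depth_lt e
      | tail _ h ih => exact ih.trans (h ▸ depth_lt _)
    exact fun e h => lt_irrefl _ (key e e h)

/-- The session that a receiver requires; nodes that are not receivers require none. -/
def demand [NeZero N] : Node N → Option (Session N)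
  | .sink₀ α => some α
  | .sink₁ _ => some (full N)
  | .upper _ => some (full N)
  | .lower t => some t.set
  | _ => none

/-- The connection requirement. -/
def requirement (N : ℕ) [NeZero N] : ConnectionRequirement (Session N) (Node N) where
  origin := Node.source
  destinations := fun α => {p | demand p = some α}

/-- The source rates induced by `h`. -/
def rate (h : Finset (Fin N) → ℝ) (α : Session N) : ℝ := h α.1

/-- `cap` is an assignment of capacities induced by `h`. The capacitated edges have the prescribed
capacities; the capacities of the other edges are infinite or at least the sum of all the values
of `h`. The edge `W**` may have capacity `h α`, more than that, or be uncapacitated: this makes no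
difference, since it only collects `V_α`. -/
def IsInducedCapacity (h : Finset (Fin N) → ℝ) (cap : Edge N → WithTop ℝ) : Prop :=
  (∀ j, cap (.V j) = (h {j} : ℝ)) ∧
  (∀ α, cap (.W₀ α) = (h α.1 : ℝ)) ∧
  (∀ α, cap (.W₁ α) = (h Finset.univ - h α.1 : ℝ)) ∧
  (∀ α, cap (.W₁' α) = (h α.1 : ℝ)) ∧
  (∀ t, cap (.W₂ t) = (h t.set.1 : ℝ)) ∧
  (∀ t, cap (.W₂' t) = (h Finset.univ - h t.set.1 : ℝ)) ∧
  (∀ t, cap (.W₂'' t) = (h (insert t.elt t.set.1) - h {t.elt} : ℝ)) ∧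
  (∀ t, cap (.Wstar t) = (h t.set.1 : ℝ)) ∧
  (∀ t, (h t.set.1 : ℝ) ≤ cap (.Wstarstar t)) ∧
  (∀ p, (∑ α, h α : ℝ) ≤ cap (.in₁ p)) ∧
  (∀ p, (∑ α, h α : ℝ) ≤ cap (.in₂ p)) ∧
  (∀ t, ∀ e ∈ ({.sideEncode t, .sideDecode t, .sourceMix t, .sourceUpper t, .splitMix t,
      .splitEncode t, .forkUpper t, .forkLower t} : Set (Edge N)), (∑ α, h α : ℝ) ≤ cap e)

end Dagger

end

/-! For a uniform element of a finite abelian group, the coset of `K` has entropy equal to the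
logarithm of the index of `K`, families of cosets correspond to intersections of subgroups, and "X
determines Y" becomes containment of subgroups. The symbols of a linear code are described in this
way by their kernels in the space of source vectors, those of an abelian group code by the given
subgroups after relabelling. Each encoder and decoder then yields a containment, and both necessity
claims reduce to `logIndex_iInf_V`: the joint entropy of the `V_j`, `j ∈ α`, is `h α`.

Write `V_α` for these `V_j` jointly and `H` for entropy. Type 0 forces `H(S_α) = h α`, and type 1
forces `H(V_α) ≥ h α`. The reverse bound is by induction, adding an element `i` to `α`. Suppose
`H(V_α) = h α`. The upper receiver obtains `S_N`, independent of `S_α`, from `W`, `W'` and `S_α`, so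
`H(W, S_α) ≥ 2 h(α)`. But `W` is a function of `S_α` and `W**`, and `H(W**) ≤ H(V_α) = h α`. Hence
everything is tight: `W**` is equivalent to `V_α`, and `(W, S_α)` to `(W**, S_α)`. The lower
receiver's inputs are functions of `W''`, `V_i` and `W`, which therefore determine `S_α` and then
`W**`, so `H(V_α, V_i, W) ≤ h(α ∪ i) + h α`. Given `S_N`, the symbol `W` still reveals `S_α` and so
contributes at least `h α`; subtracting this by submodularity leaves `H(V_α, V_i) ≤ h(α ∪ i)`.

Conversely, subspaces `W_j` of `V` give a linear code: `S_α` takes values in the quotient by `⋂_{j ∈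
α} W_j`, the `V_j` are projections of `S_N`, and the edge `W` of type 2 carries the sum of `V_α` and
`S_α`. Edges whose capacity is a difference of values of `h` carry quotients by relative
complements. These exist for subspaces but not for general subgroups, so this construction serves
the linear case only. -/

/-- The logarithm to base 2 of the index of a subgroup, that is, the entropy of the coset of the
subgroup that contains a uniformly distributed element. -/
noncomputable def AddSubgroup.logIndex {G : Type u} [AddCommGroup G] (K : AddSubgroup G) : ℝ :=
  Real.logb 2 K.index

/-! ### Entropy calculus for indices of subgroups -/

namespace AddSubgroup

variable {G : Type u} [AddCommGroup G] [Finite G]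

theorem index_cast_pos (K : AddSubgroup G) : (0 : ℝ) < K.index := by
  exact_mod_cast Nat.pos_of_ne_zero K.index_ne_zero_of_finite

theorem logIndex_nonneg (K : AddSubgroup G) : 0 ≤ K.logIndex :=
  Real.logb_nonneg one_lt_two (by exact_mod_cast Nat.pos_of_ne_zero K.index_ne_zero_of_finite)

omit [Finite G] in
theorem logIndex_top : (⊤ : AddSubgroup G).logIndex = 0 := by simp [logIndex]

theorem logIndex_anti {K L : AddSubgroup G} (h : K ≤ L) : L.logIndex ≤ K.logIndex :=
  Real.logb_le_logb_of_le one_lt_two L.index_cast_pos (by exact_mod_cast index_antitone h)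

/-- A variable that is determined by another one of no greater entropy also determines it: nested
subgroups of equal finite index coincide. -/
theorem le_of_logIndex_le {K L : AddSubgroup G} (h : K ≤ L) (h' : K.logIndex ≤ L.logIndex) :
    L ≤ K := by
  have h1 : K.index ≤ L.index := by
    exact_mod_cast (Real.logb_le_logb one_lt_two K.index_cast_pos L.index_cast_pos).1 h'
  have h2 := relIndex_mul_index h
  have h3 := Nat.pos_of_ne_zero L.index_ne_zero_of_finite
  have h4 := Nat.pos_of_ne_zero K.index_ne_zero_of_finite
  rw [← relIndex_eq_one]
  have : K.relIndex L ≠ 0 := fun h0 => by simp [h0] at h2; omega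
  nlinarith [Nat.pos_of_ne_zero this]

/-- Submodularity of entropy, for a variable `M` determined by both `K` and `L`. It rests on `[K : K
∩ L] ≤ [M : L]`. -/
theorem logIndex_inf_add_le {K L M : AddSubgroup G} (hK : K ≤ M) (hL : L ≤ M) :
    (K ⊓ L).logIndex + M.logIndex ≤ K.logIndex + L.logIndex := by
  have key : (K ⊓ L).index * M.index ≤ K.index * L.index := by
    rw [← relIndex_mul_index (inf_le_left : K ⊓ L ≤ K), inf_relIndex_left, ← relIndex_mul_index hL]
    have : L.relIndex K ≤ L.relIndex M := relIndex_le_of_le_right hK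
      fun h0 => L.index_ne_zero_of_finite (by rw [← relIndex_mul_index hL, h0, zero_mul])
    nlinarith [Nat.mul_le_mul this (le_refl (K.index * M.index))]
  unfold logIndex
  rw [← Real.logb_mul (index_cast_pos _).ne' (index_cast_pos _).ne',
    ← Real.logb_mul (index_cast_pos _).ne' (index_cast_pos _).ne']
  refine Real.logb_le_logb_of_le one_lt_two (mul_pos (index_cast_pos _) (index_cast_pos _)) ?_
  exact_mod_cast key

theorem logIndex_inf_le (K L : AddSubgroup G) :
    (K ⊓ L).logIndex ≤ K.logIndex + L.logIndex := by
  simpa [logIndex_top] using logIndex_inf_add_le (le_top : K ≤ ⊤) (le_top : L ≤ ⊤)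

/-- The condition `K ⊔ L = ⊤` expresses independence of the two cosets: every coset of `K` meets
every coset of `L`. -/
theorem logIndex_inf_of_sup_eq_top {K L : AddSubgroup G} (h : K ⊔ L = ⊤) :
    (K ⊓ L).logIndex = K.logIndex + L.logIndex := by
  unfold logIndex
  rw [← Real.logb_mul (index_cast_pos _).ne' (index_cast_pos _).ne',
    ← relIndex_mul_index (inf_le_left : K ⊓ L ≤ K), inf_relIndex_left, ← relIndex_sup_right, h,
    relIndex_top_right]
  push_cast
  rw [mul_comm]

end AddSubgroup

/-! ### Decoding in the network and the resulting entropy bounds -/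

namespace Dagger

variable {N : ℕ} [NeZero N]

/-- A set of source and edge symbols that contains each symbol that, in any zero-error code, is
determined at some node by the available symbols in the set. -/
structure IsDecodingClosed (Q : Session N ⊕ Edge N → Prop) : Prop where
  edge : ∀ e, (∀ f, AvailableAt (network N) (requirement N) (tail e) f → Q f) → Q (Sum.inr e)
  sink : ∀ p s, demand p = some s →
    (∀ f, AvailableAt (network N) (requirement N) p f → Q f) → Q (Sum.inl s)

theorem forall_available_iff {Q : Session N ⊕ Edge N → Prop} {p : Node N} :
    (∀ f, AvailableAt (network N) (requirement N) p f → Q f) ↔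
      (∀ s, Node.source s = p → Q (Sum.inl s)) ∧ ∀ e, head e = p → Q (Sum.inr e) :=
  Sum.forall

namespace IsDecodingClosed

variable {Q : Session N ⊕ Edge N → Prop} (hQ : IsDecodingClosed Q)
include hQ

theorem edge_of_source {e : Edge N} {s : Session N} (he : tail e = .source s)
    (hs : Q (Sum.inl s)) : Q (Sum.inr e) := by
  refine hQ.edge e (forall_available_iff.2 ⟨fun s' h => ?_, fun f h => ?_⟩)
  · rw [he] at h
    cases h
    exact hs
  · rw [he] at h
    cases f <;> cases h

theorem edge_of_hub {e : Edge N} {j : Fin N} (he : tail e = .hub j)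
    (hj : Q (Sum.inr (.V j))) : Q (Sum.inr e) := by
  refine hQ.edge e (forall_available_iff.2 ⟨fun s' h => ?_, fun f h => ?_⟩)
  · rw [he] at h
    cases h
  · rw [he] at h
    cases f <;> cases h
    exact hj

theorem W₁' {α : Session N} (h : ∀ j ∈ α.1, Q (Sum.inr (.V j))) : Q (Sum.inr (.W₁' α)) := by
  refine hQ.edge _ (forall_available_iff.2 ⟨fun _ h => (nomatch h), fun f hf => ?_⟩)
  cases f <;> cases hf
  rename_i p
  exact hQ.edge_of_hub rfl (h _ p.2)

theorem Wstarstar {t : Pair N} (h : ∀ j ∈ t.1.1, Q (Sum.inr (.V j))) :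
    Q (Sum.inr (.Wstarstar t)) := by
  refine hQ.edge _ (forall_available_iff.2 ⟨fun _ h => (nomatch h), fun f hf => ?_⟩)
  cases f <;> cases hf
  rename_i p
  exact hQ.edge_of_hub rfl (h _ p.2)

theorem edge_of_split {e : Edge N} {t : Pair N} (he : tail e = .split t)
    (h : Q (Sum.inr (.Wstarstar t))) : Q (Sum.inr e) := by
  refine hQ.edge e (forall_available_iff.2 ⟨fun s' h => ?_, fun f h => ?_⟩)
  · rw [he] at h
    cases h
  · rw [he] at h
    cases f <;> cases h
    exact ‹_›

theorem edge_of_fork {e : Edge N} {t : Pair N} (he : tail e = .fork t)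
    (h : Q (Sum.inr (.W₂ t))) : Q (Sum.inr e) := by
  refine hQ.edge e (forall_available_iff.2 ⟨fun s' h => ?_, fun f h => ?_⟩)
  · rw [he] at h
    cases h
  · rw [he] at h
    cases f <;> cases h
    exact ‹_›

theorem W₂ {t : Pair N} (h : Q (Sum.inr (.Wstarstar t))) (hs : Q (Sum.inl t.set)) :
    Q (Sum.inr (.W₂ t)) := by
  refine hQ.edge _ (forall_available_iff.2 ⟨fun _ h => (nomatch h), fun f hf => ?_⟩)
  cases f <;> cases hf
  · exact hQ.edge_of_source rfl hs
  · exact hQ.edge_of_split rfl h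

theorem W₂'' {t : Pair N} (h : Q (Sum.inr (.Wstarstar t))) (hV : Q (Sum.inr (.V t.elt))) :
    Q (Sum.inr (.W₂'' t)) := by
  refine hQ.edge _ (forall_available_iff.2 ⟨fun _ h => (nomatch h), fun f hf => ?_⟩)
  cases f <;> cases hf
  · exact hQ.edge_of_hub rfl hV
  · exact hQ.edge_of_split rfl h

theorem Wstar {t : Pair N} (h : Q (Sum.inr (.W₂'' t))) (hV : Q (Sum.inr (.V t.elt))) :
    Q (Sum.inr (.Wstar t)) := by
  refine hQ.edge _ (forall_available_iff.2 ⟨fun _ h => (nomatch h), fun f hf => ?_⟩)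
  cases f <;> cases hf
  · exact h
  · exact hQ.edge_of_hub rfl hV

theorem source₀ {α : Session N} (h : Q (Sum.inr (.W₀ α))) : Q (Sum.inl α) := by
  refine hQ.sink (.sink₀ α) _ rfl (forall_available_iff.2 ⟨fun _ h => (nomatch h), fun f hf => ?_⟩)
  cases f <;> cases hf
  exact h

theorem full₁ {α : Session N} (h : Q (Sum.inr (.W₁ α))) (h' : Q (Sum.inr (.W₁' α))) :
    Q (Sum.inl (full N)) := by
  refine hQ.sink (.sink₁ α) _ rfl (forall_available_iff.2 ⟨fun _ h => (nomatch h), fun f hf => ?_⟩)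
  cases f <;> cases hf
  · exact h
  · exact h'

theorem full₂ {t : Pair N} (h : Q (Sum.inr (.W₂ t))) (h' : Q (Sum.inr (.W₂' t)))
    (hs : Q (Sum.inl t.set)) : Q (Sum.inl (full N)) := by
  refine hQ.sink (.upper t) _ rfl (forall_available_iff.2 ⟨fun _ h => (nomatch h), fun f hf => ?_⟩)
  cases f <;> cases hf
  · exact h'
  · exact hQ.edge_of_source rfl hs
  · exact hQ.edge_of_fork rfl h

theorem source₂ {t : Pair N} (h : Q (Sum.inr (.W₂ t))) (h' : Q (Sum.inr (.Wstar t))) :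
    Q (Sum.inl t.set) := by
  refine hQ.sink (.lower t) _ rfl (forall_available_iff.2 ⟨fun _ h => (nomatch h), fun f hf => ?_⟩)
  cases f <;> cases hf
  · exact h'
  · exact hQ.edge_of_fork rfl h

end IsDecodingClosed

theorem Pair.set_ne_full (t : Pair N) : t.set ≠ full N := by
  intro h
  have := congrArg Subtype.val h
  exact t.2.2 (by rw [show t.1.1 = Finset.univ from this]; exact Finset.mem_univ _)

/-- Subgroups that behave like the source and edge symbols of a zero-error code within the
rates and capacities induced by `h` represent `h`. -/
theorem logIndex_iInf_V {h : Finset (Fin N) → ℝ} (h_empty : h ∅ = 0)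
    {cap : Edge N → WithTop ℝ} (h_cap : IsInducedCapacity h cap)
    {G : Type u} [AddCommGroup G] [Finite G] (K : Session N ⊕ Edge N → AddSubgroup G)
    (hK : ∀ g, IsDecodingClosed fun f => g ∈ K f)
    (indep : ∀ s t, s ≠ t → K (Sum.inl s) ⊔ K (Sum.inl t) = ⊤)
    (hrate : ∀ s, rate h s ≤ (K (Sum.inl s)).logIndex)
    (hcap : ∀ e, ((K (Sum.inr e)).logIndex : WithTop ℝ) ≤ cap e) (α : Finset (Fin N)) :
    (⨅ j ∈ α, K (Sum.inr (.V j))).logIndex = h α := by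
  obtain ⟨cV, cW₀, cW₁, cW₁', cW₂, cW₂', cW₂'', -⟩ := h_cap
  have bound : ∀ {e : Edge N} {r : ℝ}, cap e = r → (K (Sum.inr e)).logIndex ≤ r :=
    fun {e r} he => WithTop.coe_le_coe.1 (he ▸ hcap e)
  have source_eq (s : Session N) : (K (Sum.inl s)).logIndex = h s.1 := by
    refine le_antisymm ?_ (hrate s)
    exact (AddSubgroup.logIndex_anti fun g hg => (hK g).source₀ hg).trans (bound (cW₀ s))
  have mem_iInf (β : Finset (Fin N)) (g : G) :
      g ∈ (⨅ j ∈ β, K (Sum.inr (.V j))) ↔ ∀ j ∈ β, g ∈ K (Sum.inr (.V j)) := by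
    simp [AddSubgroup.mem_iInf]
  -- Type 1: `W` and `V_β` determine `S_N`, and `W` supplies at most `h univ - h β`.
  have lower (β : Finset (Fin N)) (hβ : β.Nonempty) :
      h β ≤ (⨅ j ∈ β, K (Sum.inr (.V j))).logIndex := by
    have h1 : K (Sum.inr (.W₁ ⟨β, hβ⟩)) ⊓ (⨅ j ∈ β, K (Sum.inr (.V j))) ≤ K (Sum.inl (full N)) :=
      fun g hg => (hK g).full₁ hg.1 ((hK g).W₁' ((mem_iInf β g).1 hg.2))
    have h2 := (AddSubgroup.logIndex_anti h1).trans (AddSubgroup.logIndex_inf_le _ _)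
    have h3 := bound (cW₁ ⟨β, hβ⟩)
    have h4 := source_eq (full N)
    simp only [full] at h2 h3 h4
    linarith
  have V_le (j : Fin N) : K (Sum.inl (full N)) ≤ K (Sum.inr (.V j)) :=
    fun g hg => (hK g).edge_of_source rfl hg
  have upper_insert (t : Pair N)
      (ih : (⨅ j ∈ t.1.1, K (Sum.inr (.V j))).logIndex = h t.1.1) :
      ((⨅ j ∈ t.1.1, K (Sum.inr (.V j))) ⊓ K (Sum.inr (.V t.elt))).logIndex ≤
        h (insert t.elt t.1.1) := by
    set V := ⨅ j ∈ t.1.1, K (Sum.inr (.V j))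
    set S := K (Sum.inl (full N))
    set A := K (Sum.inl t.set)
    set B := K (Sum.inr (.Wstarstar t))
    set W := K (Sum.inr (.W₂ t))
    set W' := K (Sum.inr (.W₂' t))
    set C := K (Sum.inr (.W₂'' t)) ⊓ K (Sum.inr (.V t.elt))
    have hS : S.logIndex = h Finset.univ := source_eq (full N)
    have hA : A.logIndex = h t.1.1 := source_eq t.set
    have hW : W.logIndex ≤ h t.1.1 := bound (cW₂ t)
    have hW' : W'.logIndex ≤ h Finset.univ - h t.1.1 := bound (cW₂' t)
    have hW'' : (K (Sum.inr (.W₂'' t))).logIndex ≤ h (insert t.elt t.1.1) - h {t.elt} :=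
      bound (cW₂'' t)
    have hVi : (K (Sum.inr (.V t.elt))).logIndex ≤ h {t.elt} := bound (cV t.elt)
    have hC : C.logIndex ≤ h (insert t.elt t.1.1) := by
      have : C.logIndex ≤ _ := AddSubgroup.logIndex_inf_le _ _
      linarith
    have hSA : (S ⊓ A).logIndex = S.logIndex + A.logIndex :=
      AddSubgroup.logIndex_inf_of_sup_eq_top (indep _ _ t.set_ne_full.symm)
    have V_le_B : V ≤ B := fun g hg => (hK g).Wstarstar ((mem_iInf _ g).1 hg)
    have BA_le_W : B ⊓ A ≤ W := fun g hg => (hK g).W₂ hg.1 hg.2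
    -- Upper receiver: `W`, `W'` and `S_α` determine the independent pair `(S_N, S_α)`.
    have hWA : S.logIndex + A.logIndex ≤ (W ⊓ A).logIndex + W'.logIndex := by
      rw [← hSA]
      refine le_trans (AddSubgroup.logIndex_anti ?_) (AddSubgroup.logIndex_inf_le (W ⊓ A) W')
      exact fun g hg => ⟨(hK g).full₂ hg.1.1 hg.2 hg.1.2, hg.1.2⟩
    have hBA : (W ⊓ A).logIndex ≤ (B ⊓ A).logIndex :=
      AddSubgroup.logIndex_anti (le_inf BA_le_W inf_le_right)
    have hBA' := AddSubgroup.logIndex_inf_le B A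
    have hBV := AddSubgroup.logIndex_anti V_le_B
    -- The chain `2 h(α) ≤ H(W, A) ≤ H(B, A) ≤ H(B) + H(A) ≤ H(V) + H(A) = 2 h(α)` is tight, which
    -- turns two one-sided containments into equalities.
    have B_le_V : B ≤ V := AddSubgroup.le_of_logIndex_le V_le_B (by linarith)
    have WA_le_BA : W ⊓ A ≤ B ⊓ A :=
      AddSubgroup.le_of_logIndex_le (le_inf BA_le_W inf_le_right) (by linarith)
    -- Lower receiver: `C` yields `W*`, which with `W` yields `A`; then `(W, A)` yields `B` by
    -- tightness.
    have CW_le_B : C ⊓ W ≤ B := fun g hg =>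
      (WA_le_BA ⟨hg.2, (hK g).source₂ hg.2 ((hK g).Wstar hg.1.1 hg.1.2)⟩).1
    have BVi_le_C : B ⊓ K (Sum.inr (.V t.elt)) ≤ C :=
      fun g hg => ⟨(hK g).W₂'' hg.1 hg.2, hg.2⟩
    have S_le_BVi : S ≤ B ⊓ K (Sum.inr (.V t.elt)) :=
      le_inf ((le_iInf₂ fun j _ => V_le j).trans V_le_B) (V_le _)
    -- `S` determines every `V_j`, hence `W''` and `W*`, so `S` and `W` determine `A`.
    have hSW : (S ⊓ A).logIndex ≤ (S ⊓ W).logIndex := by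
      refine AddSubgroup.logIndex_anti fun g hg => ⟨hg.1, ?_⟩
      have hC := BVi_le_C (S_le_BVi hg.1)
      exact (hK g).source₂ hg.2 ((hK g).Wstar hC.1 hC.2)
    set D := B ⊓ K (Sum.inr (.V t.elt))
    -- Submodularity for `(D, W)` and `S`, which share `D`: the joint entropy is at least `H(S) +
    -- H(A)`, while `H(D, W) ≤ H(C) + H(W)`. The terms `H(S)` and `h α` cancel.
    have hsub := AddSubgroup.logIndex_inf_add_le (inf_le_left : D ⊓ W ≤ D) S_le_BVi
    have h1 : (S ⊓ W).logIndex ≤ (D ⊓ W ⊓ S).logIndex :=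
      AddSubgroup.logIndex_anti fun g hg => ⟨hg.2, hg.1.2⟩
    have h2 : (D ⊓ W).logIndex ≤ (C ⊓ W).logIndex :=
      AddSubgroup.logIndex_anti fun g hg => ⟨⟨CW_le_B hg, hg.1.2⟩, hg.2⟩
    have h3 := AddSubgroup.logIndex_inf_le C W
    have h4 : (V ⊓ K (Sum.inr (.V t.elt))).logIndex ≤ D.logIndex :=
      AddSubgroup.logIndex_anti (inf_le_inf_right _ B_le_V)
    linarith
  induction α using Finset.induction_on with
  | empty => simp [h_empty, AddSubgroup.logIndex_top]
  | insert i β hi ih =>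
    refine le_antisymm ?_ (lower _ (Finset.insert_nonempty i β))
    rw [Finset.iInf_insert, inf_comm]
    rcases β.eq_empty_or_nonempty with rfl | hβ
    · simpa using bound (cV i)
    · exact upper_insert ⟨(β, i), hβ, hi⟩ ih

end Dagger

/-! ### Entropy of coset variables and equivalence of laws -/

theorem mem_support_map_uniformLaw {X : Type u} [Finite X] [Nonempty X] {Y : Type v} (f : X → Y)
    (y : Y) : y ∈ ((uniformLaw X).map f).support ↔ ∃ x, f x = y := by
  let := Fintype.ofFinite X
  simp [uniformLaw, PMF.support_map]

/-- The nonempty fibres of a homomorphism are cosets of the kernel, so the image of the uniform law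
is uniform on the range. -/
theorem map_uniformLaw_apply {G A : Type u} [AddCommGroup G] [Finite G] [AddCommGroup A]
    (φ : G →+ A) (a : A) [Decidable (a ∈ φ.range)] :
    ((uniformLaw G).map φ a).toReal = if a ∈ φ.range then (φ.ker.index : ℝ)⁻¹ else 0 := by
  classical
  let := Fintype.ofFinite G
  split_ifs with ha
  · have h1 : (uniformLaw G).map φ a
        = ∑ g : G, if a = φ g then (Fintype.card G : ENNReal)⁻¹ else 0 := by
      rw [PMF.map_apply, tsum_fintype]
      refine Finset.sum_congr rfl fun g _ => ?_
      congr 1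
      exact PMF.uniformOfFintype_apply g
    have h2 : (Finset.univ.filter fun g => a = φ g).card = Nat.card φ.ker := by
      obtain ⟨b, rfl⟩ := ha
      rw [Nat.card_eq_fintype_card, Fintype.card_subtype]
      have h := AddMonoidHom.card_fiber_eq_of_mem_range φ (x := φ b) (y := 0) ⟨b, rfl⟩ ⟨0, map_zero φ⟩
      simpa [AddMonoidHom.mem_ker, eq_comm] using h
    have h3 := φ.ker.card_mul_index
    have h4 : (Nat.card φ.ker : ℝ) ≠ 0 := by exact_mod_cast Nat.card_pos.ne'
    rw [h1, Finset.sum_ite, Finset.sum_const_zero, add_zero, Finset.sum_const, h2,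
      ← Nat.card_eq_fintype_card, ← h3]
    simp only [nsmul_eq_mul, ENNReal.toReal_mul, ENNReal.toReal_natCast, ENNReal.toReal_inv]
    push_cast
    rw [mul_inv, ← mul_assoc, mul_inv_cancel₀ h4, one_mul]
  · rw [(PMF.apply_eq_zero_iff _ _).2 fun h => ha ((mem_support_map_uniformLaw φ a).1 h),
      ENNReal.toReal_zero]

theorem shannonEntropy_map_uniformLaw {G A : Type u} [AddCommGroup G] [Finite G] [AddCommGroup A]
    [Finite A] (φ : G →+ A) :
    shannonEntropy ((uniformLaw G).map φ) = φ.ker.logIndex := by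
  classical
  let := Fintype.ofFinite A
  have h0 : (φ.ker.index : ℝ) ≠ 0 := φ.ker.index_cast_pos.ne'
  have h1 : (Finset.univ.filter fun a => a ∈ φ.range).card = φ.ker.index := by
    rw [AddSubgroup.index_ker, Nat.card_eq_fintype_card, Fintype.card_subtype]
  unfold shannonEntropy
  rw [tsum_fintype]
  simp only [map_uniformLaw_apply]
  calc _ = ∑ a : A, if a ∈ φ.range then (φ.ker.index : ℝ)⁻¹ * φ.ker.logIndex else 0 := by
        refine Finset.sum_congr rfl fun a _ => ?_
        split_ifs <;> simp [AddSubgroup.logIndex]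
    _ = φ.ker.logIndex := by
        rw [Finset.sum_ite, Finset.sum_const_zero, add_zero, Finset.sum_const, h1, nsmul_eq_mul,
          ← mul_assoc, mul_inv_cancel₀ h0, one_mul]

/-- The map to the tuple of cosets is a homomorphism whose kernel is the intersection. -/
theorem entropyFunction_cosetLaw {ι : Type} {G : Type u} [AddCommGroup G] [Finite G]
    (K : ι → AddSubgroup G) (α : Finset ι) :
    entropyFunction (cosetLaw G K) α = (⨅ j ∈ α, K j).logIndex := by
  let φ : G →+ ∀ i : {i // i ∈ α}, G ⧸ K i :=
    { toFun := fun g i => (g : G ⧸ K i), map_zero' := rfl, map_add' := fun _ _ => rfl }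
  have h1 : φ.ker = ⨅ j ∈ α, K j := by
    ext g
    simp only [AddMonoidHom.mem_ker, AddSubgroup.mem_iInf]
    refine funext_iff.trans (Subtype.forall.trans (forall₂_congr fun j _ => ?_))
    exact QuotientAddGroup.eq_zero_iff g
  rw [← h1, ← shannonEntropy_map_uniformLaw]
  unfold entropyFunction cosetLaw
  rw [PMF.map_comp]
  rfl

/-- Equivalent families of functions of uniformly distributed variables can be matched. -/
theorem EquivalentLaws.exists_matching {ι : Type v} {A B : ι → Type u} {X Y : Type u} [Finite X]
    [Nonempty X] [Finite Y] [Nonempty Y] {s : X → ∀ i, A i} {r : Y → ∀ i, B i}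
    (h : EquivalentLaws ((uniformLaw X).map s) ((uniformLaw Y).map r)) :
    ∃ R : X → Y → Prop, (∀ x, ∃ y, R x y) ∧ (∀ y, ∃ x, R x y) ∧
      ∀ x y x' y', R x y → R x' y' → ∀ i, s x i = s x' i ↔ r y i = r y' i := by
  obtain ⟨τ, hτ⟩ := h
  have hs (x : X) (i : ι) : s x i ∈ (((uniformLaw X).map s).map fun z => z i).support := by
    rw [PMF.map_comp, mem_support_map_uniformLaw]
    exact ⟨x, rfl⟩
  have hr (y : Y) (i : ι) : r y i ∈ (((uniformLaw Y).map r).map fun z => z i).support := by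
    rw [PMF.map_comp, mem_support_map_uniformLaw]
    exact ⟨y, rfl⟩
  -- `x` and `y` are related when `τ` carries each variable of `x` to that of `y`. Probabilities
  -- matter only through supports: `τ` sends attained tuples to tuples of positive probability,
  -- which are again attained, and likewise for its inverse.
  refine ⟨fun x y => ∀ i, τ i ⟨s x i, hs x i⟩ = ⟨r y i, hr y i⟩, fun x => ?_, fun y => ?_, ?_⟩
  · have h1 := (mem_support_map_uniformLaw s _).2 ⟨x, rfl⟩
    rw [PMF.mem_support_iff, hτ fun i => ⟨s x i, hs x i⟩, ← PMF.mem_support_iff,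
      mem_support_map_uniformLaw] at h1
    obtain ⟨y, hy⟩ := h1
    exact ⟨y, fun i => Subtype.ext (congrFun hy i).symm⟩
  · have h1 := (mem_support_map_uniformLaw r _).2 ⟨y, rfl⟩
    have h2 := hτ fun i => (τ i).symm ⟨r y i, hr y i⟩
    simp only [Equiv.apply_symm_apply] at h2
    rw [PMF.mem_support_iff, ← h2, ← PMF.mem_support_iff, mem_support_map_uniformLaw] at h1
    obtain ⟨x, hx⟩ := h1
    refine ⟨x, fun i => ?_⟩
    rw [← Equiv.eq_symm_apply]
    exact Subtype.ext (congrFun hx i)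
  · intro x y x' y' hx hx' i
    rw [← Subtype.mk_eq_mk (h := hr y i) (h' := hr y' i), ← hx i, ← hx' i, (τ i).injective.eq_iff,
      Subtype.mk_eq_mk]

/-! ### From admissible codes to subgroups -/

namespace Dagger

variable {N : ℕ} [NeZero N]

/-- Two source vectors that agree on the inputs of an encoder or decoder agree on its output. -/
theorem isDecodingClosed_symbol_eq {c : NetworkCode.{u} (network N) (requirement N)}
    (hc : c.ZeroError) (x y : ∀ s, c.alphabet (Sum.inl s)) :
    IsDecodingClosed fun f => c.symbol x f = c.symbol y f where
  edge e h := by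
    rw [c.symbol_inr, c.symbol_inr]
    congr 1
    exact funext fun f => h f f.2
  sink p s hp h := by
    obtain ⟨d, hd⟩ := hc s p hp
    change x s = y s
    rw [← hd x, ← hd y]
    congr 1
    exact funext fun f => h f f.2

/-- If the symbols of an admissible zero-error code are matched with the cosets of subgroups of
a finite abelian group, then the subgroups that belong to the edges `V j` represent `h`. -/
theorem logIndex_iInf_V_of_matching {h : Finset (Fin N) → ℝ} (h_empty : h ∅ = 0)
    {cap : Edge N → WithTop ℝ} (h_cap : IsInducedCapacity h cap)
    {c : NetworkCode.{u} (network N) (requirement N)} (hc : c.ZeroError)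
    (hcap : ∀ e, ((Real.logb 2 (Nat.card (c.alphabet (Sum.inr e))) : ℝ) : WithTop ℝ) ≤ cap e)
    (hrate : ∀ s, rate h s ≤ Real.logb 2 (Nat.card (c.alphabet (Sum.inl s))))
    {G : Type u} [AddCommGroup G] [Finite G] (K : Session N ⊕ Edge N → AddSubgroup G)
    (R : (∀ s, c.alphabet (Sum.inl s)) → G → Prop) (left : ∀ x, ∃ g, R x g)
    (right : ∀ g, ∃ x, R x g)
    (hR : ∀ x g x' g', R x g → R x' g' → ∀ f, c.symbol x f = c.symbol x' f ↔ g - g' ∈ K f)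
    (α : Finset (Fin N)) : (⨅ j ∈ α, K (Sum.inr (.V j))).logIndex = h α := by
  classical
  have := c.finite_alphabet
  have := c.nonempty_alphabet
  choose p hp using right
  choose q hq using left
  refine logIndex_iInf_V h_empty h_cap K (fun g => ?_) (fun s t hst => ?_) (fun s => ?_)
    (fun e => ?_) α
  -- Membership of `g` in `K f` says that vectors matched with `g` and with `0` agree in symbol `f`.
  · convert isDecodingClosed_symbol_eq hc (p g) (p 0) using 2 with f
    simp [hR _ _ _ _ (hp g) (hp 0) f]
  · refine eq_top_iff.2 fun g _ => ?_
    -- Source symbols can be prescribed separately: `x` agrees with `p g` at `s` and with `p 0` at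
    -- `t`, so `g = (g - q x) + q x` is the required splitting.
    let x := Function.update (p g) t (p 0 t)
    have h1 : g - q x ∈ K (Sum.inl s) := (hR _ _ _ _ (hp g) (hq x) (Sum.inl s)).1
      (show p g s = x s from (Function.update_of_ne hst _ _).symm)
    have h2 : q x - 0 ∈ K (Sum.inl t) := (hR _ _ _ _ (hq x) (hp 0) (Sum.inl t)).1
      (show x t = p 0 t from Function.update_self _ _ _)
    rw [sub_zero] at h2
    rw [← sub_add_cancel g (q x)]
    exact AddSubgroup.add_mem_sup h1 h2
  · refine (hrate s).trans (Real.logb_le_logb_of_le one_lt_two (by exact_mod_cast Nat.card_pos) ?_)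
    rw [AddSubgroup.index_eq_card]
    -- Varying the symbol of `s` alone realizes every letter, and distinct letters fall in distinct
    -- cosets.
    let x (a : c.alphabet (Sum.inl s)) := Function.update (p 0) s a
    refine Nat.cast_le.2 (Nat.card_le_card_of_injective
      (fun a => (q (x a) : G ⧸ K (Sum.inl s))) fun a b hab => ?_)
    have h1 := (hR _ _ _ _ (hq (x a)) (hq (x b)) (Sum.inl s)).2
      (QuotientAddGroup.eq_iff_sub_mem.1 hab)
    change x a s = x b s at h1
    simpa [x] using h1
  · refine le_trans (WithTop.coe_le_coe.2 ?_) (hcap e)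
    refine Real.logb_le_logb_of_le one_lt_two (AddSubgroup.index_cast_pos _) ?_
    rw [AddSubgroup.index_eq_card]
    -- For edges, the injection goes the other way: distinct cosets give distinct letters, though
    -- not every letter need occur.
    refine Nat.cast_le.2 (Nat.card_le_card_of_injective
      (fun a => c.symbol (p a.out) (Sum.inr e)) fun a b hab => ?_)
    rw [← Quotient.out_eq a, ← Quotient.out_eq b]
    exact QuotientAddGroup.eq_iff_sub_mem.2 ((hR _ _ _ _ (hp _) (hp _) _).1 hab)

theorem abelianGroupCharacterizable_of_admissible {h : Finset (Fin N) → ℝ} (h_empty : h ∅ = 0)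
    {cap : Edge N → WithTop ℝ} (h_cap : IsInducedCapacity h cap)
    (hadm : AdmissibleBy (net := network N) (M := requirement N)
      NetworkCode.IsAbelianGroupCode.{u} (rate h) cap) :
    AbelianGroupCharacterizable.{u} h := by
  obtain ⟨c, ⟨G, _, _, K, hGK⟩, hc, hcap, hrate⟩ := hadm
  have := c.finite_alphabet
  have := c.nonempty_alphabet
  obtain ⟨R, left, right, hR⟩ := EquivalentLaws.exists_matching hGK
  refine ⟨G, _, ‹_›, fun j => K (Sum.inr (.V j)), funext fun α => ?_⟩
  rw [entropyFunction_cosetLaw]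
  refine (logIndex_iInf_V_of_matching h_empty h_cap hc hcap hrate K R left right ?_ α).symm
  exact fun x g x' g' hx hx' f =>
    (hR x g x' g' hx hx' f).trans QuotientAddGroup.eq_iff_sub_mem

end Dagger

/-- The source and edge symbols of a linear code depend linearly on the source symbols. -/
theorem NetworkCode.isLinearMap_symbol {S P E : Type} {net : Network P E}
    {M : ConnectionRequirement S P} (c : NetworkCode.{u} net M) (F : Type u) [Field F]
    [∀ f, AddCommGroup (c.alphabet f)] [∀ f, Module F (c.alphabet f)]
    (hc : ∀ e, IsLinearMap F (c.localMap e)) (f : S ⊕ E) :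
    IsLinearMap F fun x => c.symbol x f := by
  rcases f with s | e
  · exact ⟨fun _ _ => rfl, fun _ _ => rfl⟩
  induction e using net.wellFounded.induction with
  | _ e ih =>
    have h (f : {f // AvailableAt net M (net.tail e) f}) : IsLinearMap F fun x => c.symbol x f := by
      obtain ⟨s | f, hf⟩ := f
      · exact ⟨fun _ _ => rfl, fun _ _ => rfl⟩
      · exact ih f hf
    constructor
    · intro x y
      simp only [c.symbol_inr, ← (hc e).map_add]
      congr 1
      exact funext fun f => (h f).map_add x y
    · intro a x
      simp only [c.symbol_inr, ← (hc e).map_smul]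
      congr 1
      exact funext fun f => (h f).map_smul a x

namespace Dagger

variable {N : ℕ} [NeZero N]

theorem linearGroupCharacterizable_of_admissible (F : Type u) [Field F]
    {h : Finset (Fin N) → ℝ} (h_empty : h ∅ = 0)
    {cap : Edge N → WithTop ℝ} (h_cap : IsInducedCapacity h cap)
    (hadm : AdmissibleBy (net := network N) (M := requirement N)
      (NetworkCode.IsLinear F) (rate h) cap) :
    LinearGroupCharacterizable F h := by
  obtain ⟨c, ⟨_, _, hlin⟩, hc, hcap, hrate⟩ := hadm
  have := c.finite_alphabet
  let L (f) := (c.isLinearMap_symbol F hlin f).mk'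
  refine ⟨∀ s, c.alphabet (Sum.inl s), inferInstance, inferInstance, inferInstance,
    fun j => LinearMap.ker (L (Sum.inr (.V j))), funext fun α => ?_⟩
  rw [entropyFunction_cosetLaw]
  refine (logIndex_iInf_V_of_matching h_empty h_cap hc hcap hrate
    (fun f => (LinearMap.ker (L f)).toAddSubgroup) (· = ·) (fun x => ⟨x, rfl⟩)
    (fun x => ⟨x, rfl⟩) ?_ α).symm
  rintro x _ x' _ rfl rfl f
  have h1 : c.symbol x f - c.symbol x' f = L f (x - x') := (map_sub (L f) x x').symm
  rw [← sub_eq_zero, h1]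
  rfl

end Dagger

/-! ### Linear codes from linear functions of the sources -/

/-- The factor is forced on the range of `f` and extends to `Y` because subspaces have complements.
-/
theorem LinearMap.exists_comp_eq_of_ker_le_ker {F X Y Z : Type*} [Field F] [AddCommGroup X]
    [Module F X] [AddCommGroup Y] [Module F Y] [AddCommGroup Z] [Module F Z] (f : X →ₗ[F] Y)
    (g : X →ₗ[F] Z) (h : LinearMap.ker f ≤ LinearMap.ker g) : ∃ k : Y →ₗ[F] Z, k ∘ₗ f = g := by
  obtain ⟨k, hk⟩ := LinearMap.exists_extend
    (((LinearMap.ker f).liftQ g h) ∘ₗ f.quotKerEquivRange.symm.toLinearMap)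
  refine ⟨k, LinearMap.ext fun x => ?_⟩
  have h1 := LinearMap.congr_fun hk ⟨f x, x, rfl⟩
  have h2 : f.quotKerEquivRange.symm ⟨f x, x, rfl⟩ = Submodule.Quotient.mk x := by
    rw [LinearEquiv.symm_apply_eq]
    rfl
  simpa [h2] using h1

/-- Linear functions of the source symbols are the symbols of a zero-error linear code if each
of them is determined by those available at the tail of its edge, and each required source symbol
by those available at the receiver. -/
theorem NetworkCode.exists_isLinear_zeroError {S P E : Type} (net : Network P E)
    (M : ConnectionRequirement S P) (F : Type u) [Field F] (A : S ⊕ E → Type u)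
    [∀ f, AddCommGroup (A f)] [∀ f, Module F (A f)] [∀ f, Finite (A f)]
    (σ : ∀ f, (∀ s, A (Sum.inl s)) →ₗ[F] A f) (hσ : ∀ s x, σ (Sum.inl s) x = x s)
    (hedge : ∀ e x, (∀ f, AvailableAt net M (net.tail e) f → σ f x = 0) → σ (Sum.inr e) x = 0)
    (hdest : ∀ s, ∀ p ∈ M.destinations s, ∀ x,
      (∀ f, AvailableAt net M p f → σ f x = 0) → x s = 0) :
    ∃ c : NetworkCode.{u} net M, c.IsLinear F ∧ c.ZeroError ∧
      ∀ f, Nat.card (c.alphabet f) = Nat.card (A f) := by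
  have hφ (e : E) : ∃ φ : (∀ f : {f // AvailableAt net M (net.tail e) f}, A f) →ₗ[F]
      A (Sum.inr e), φ ∘ₗ LinearMap.pi (fun f => σ f) = σ (Sum.inr e) := by
    refine LinearMap.exists_comp_eq_of_ker_le_ker _ _ fun x hx => hedge e x fun f hf => ?_
    exact congrFun (LinearMap.mem_ker.1 hx) ⟨f, hf⟩
  choose φ hφ using hφ
  let c : NetworkCode.{u} net M := ⟨A, inferInstance, fun f => ⟨0⟩, fun e => φ e⟩
  have symbol_eq (x : ∀ s, A (Sum.inl s)) (f : S ⊕ E) : c.symbol x f = σ f x := by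
    rcases f with s | e
    · exact (hσ s x).symm
    induction e using net.wellFounded.induction with
    | _ e ih =>
      rw [c.symbol_inr, ← hφ e]
      refine congrArg (φ e) (funext fun f => ?_)
      obtain ⟨s | f, hf⟩ := f
      · exact (hσ s x).symm
      · exact ih f hf
  refine ⟨c, ⟨inferInstanceAs (∀ f, AddCommGroup (A f)), inferInstanceAs (∀ f, Module F (A f)),
    fun e => (φ e).isLinear⟩, fun s p hp => ?_, fun _ => rfl⟩
  have : Nonempty (c.alphabet (Sum.inl s)) := c.nonempty_alphabet _
  -- Any function serves as a decoder, so it is enough that vectors with equal available symbols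
  -- have equal symbol `s`; by linearity this is the kernel condition for `x - y`.
  obtain ⟨d, hd⟩ := (Function.factorsThrough_iff (fun x : ∀ s, A (Sum.inl s) => x s)
    (f := fun x (f : {f // AvailableAt net M p f}) => c.symbol x f)).1 fun x y hxy => by
      refine sub_eq_zero.1 (hdest s p hp (x - y) fun f hf => ?_)
      rw [map_sub, ← symbol_eq, ← symbol_eq, sub_eq_zero]
      exact congrFun hxy ⟨f, hf⟩
  exact ⟨d, fun x => (congrFun hd x).symm⟩

/-! ### The linear code of a family of subspaces -/

namespace Dagger

variable {N : ℕ} [NeZero N] {F : Type u} [Field F] {V : Type u} [AddCommGroup V] [Module F V]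

/-- The subspaces whose quotients are the alphabets of the linear code for `W`, where `C α` and
`D t` belong to the edges of capacities `h univ - h α` and `h (insert i α) - h {i}`. -/
def codeSubspace (W : Fin N → Submodule F V) (C : Session N → Submodule F V)
    (D : Pair N → Submodule F V) : Session N ⊕ Edge N → Submodule F V
  | .inl α => ⨅ j ∈ α.1, W j
  | .inr (.V j) => W j
  | .inr (.W₀ α) => ⨅ j ∈ α.1, W j
  | .inr (.W₁ α) => C α
  | .inr (.W₁' α) => ⨅ j ∈ α.1, W j
  | .inr (.in₁ p) => W p.1.2
  | .inr (.W₂ t) => ⨅ j ∈ t.set.1, W j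
  | .inr (.W₂' t) => C t.set
  | .inr (.W₂'' t) => D t
  | .inr (.Wstar t) => ⨅ j ∈ t.set.1, W j
  | .inr (.Wstarstar t) => ⨅ j ∈ t.set.1, W j
  | .inr (.in₂ p) => W p.1.2
  | .inr (.sideEncode t) => W t.elt
  | .inr (.sideDecode t) => W t.elt
  | .inr (.sourceMix t) => ⨅ j ∈ t.set.1, W j
  | .inr (.sourceUpper t) => ⨅ j ∈ t.set.1, W j
  | .inr (.splitMix t) => ⨅ j ∈ t.set.1, W j
  | .inr (.splitEncode t) => ⨅ j ∈ t.set.1, W j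
  | .inr (.forkUpper t) => ⨅ j ∈ t.set.1, W j
  | .inr (.forkLower t) => ⨅ j ∈ t.set.1, W j

variable (W : Fin N → Submodule F V) (C : Session N → Submodule F V) (D : Pair N → Submodule F V)

/-- The alphabets of the linear code for `W`. -/
abbrev CodeAlphabet (f : Session N ⊕ Edge N) : Type u := V ⧸ codeSubspace W C D f

/-- The source symbol of the session `α`, as a linear function of all source symbols. -/
def sourceMap (α : Session N) :
    (∀ s : Session N, CodeAlphabet W C D (.inl s)) →ₗ[F] V ⧸ (⨅ j ∈ α.1, W j) :=
  LinearMap.proj α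

variable {W} in
/-- The image in `V ⧸ U` of the source symbol of the full session. -/
def fullMap (U : Submodule F V) (hU : ⨅ j, W j ≤ U) :
    (∀ s : Session N, CodeAlphabet W C D (.inl s)) →ₗ[F] V ⧸ U :=
  Submodule.liftQ (⨅ j ∈ (full N).1, W j) U.mkQ
    (by simpa [full] using hU) ∘ₗ sourceMap W C D (full N)

omit [NeZero N] in
theorem iInf_le_biInf (α : Finset (Fin N)) : ⨅ j, W j ≤ ⨅ j ∈ α, W j :=
  le_iInf₂ fun j _ => iInf_le _ j

variable {W C D}

/-- The symbols of the linear code for `W`, as linear functions of the source symbols. -/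
def codeSymbol (hC : ∀ α, ⨅ j, W j ≤ C α) (hD : ∀ t, ⨅ j, W j ≤ D t) : ∀ f,
    (∀ s : Session N, CodeAlphabet W C D (.inl s)) →ₗ[F] CodeAlphabet W C D f
  | .inl α => LinearMap.proj α
  | .inr (.V j) => fullMap C D (W j) (iInf_le _ j)
  | .inr (.W₀ α) => sourceMap W C D α
  | .inr (.W₁ α) => fullMap C D (C α) (hC α)
  | .inr (.W₁' α) => fullMap C D (⨅ j ∈ α.1, W j) (iInf_le_biInf W α.1)
  | .inr (.in₁ p) => fullMap C D (W p.1.2) (iInf_le _ _)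
  | .inr (.W₂ t) => fullMap C D (⨅ j ∈ t.set.1, W j) (iInf_le_biInf W _) + sourceMap W C D t.set
  | .inr (.W₂' t) => fullMap C D (C t.set) (hC t.set)
  | .inr (.W₂'' t) => fullMap C D (D t) (hD t)
  | .inr (.Wstar t) => fullMap C D (⨅ j ∈ t.set.1, W j) (iInf_le_biInf W _)
  | .inr (.Wstarstar t) => fullMap C D (⨅ j ∈ t.set.1, W j) (iInf_le_biInf W _)
  | .inr (.in₂ p) => fullMap C D (W p.1.2) (iInf_le _ _)
  | .inr (.sideEncode t) => fullMap C D (W t.elt) (iInf_le _ _)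
  | .inr (.sideDecode t) => fullMap C D (W t.elt) (iInf_le _ _)
  | .inr (.sourceMix t) => sourceMap W C D t.set
  | .inr (.sourceUpper t) => sourceMap W C D t.set
  | .inr (.splitMix t) => fullMap C D (⨅ j ∈ t.set.1, W j) (iInf_le_biInf W _)
  | .inr (.splitEncode t) => fullMap C D (⨅ j ∈ t.set.1, W j) (iInf_le_biInf W _)
  | .inr (.forkUpper t) =>
      fullMap C D (⨅ j ∈ t.set.1, W j) (iInf_le_biInf W _) + sourceMap W C D t.set
  | .inr (.forkLower t) =>
      fullMap C D (⨅ j ∈ t.set.1, W j) (iInf_le_biInf W _) + sourceMap W C D t.set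

/-- With a representative `v` of `S_N` fixed, vanishing of symbols becomes membership of `v` in
subspaces, and coding conditions become inclusions. -/
theorem fullMap_eq_zero_iff {x : ∀ s : Session N, CodeAlphabet W C D (.inl s)} {v : V}
    (hv : sourceMap W C D (full N) x = Submodule.Quotient.mk v) {U : Submodule F V}
    (hU : ⨅ j, W j ≤ U) : fullMap C D U hU x = 0 ↔ v ∈ U := by
  rw [fullMap, LinearMap.comp_apply, hv]
  exact Submodule.Quotient.mk_eq_zero U

theorem fullMap_full_eq (x : ∀ s : Session N, CodeAlphabet W C D (.inl s)) :
    fullMap C D (⨅ j ∈ (full N).1, W j) (iInf_le_biInf W _) x = sourceMap W C D (full N) x := by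
  obtain ⟨v, hv⟩ := Submodule.Quotient.mk_surjective _ (sourceMap W C D (full N) x)
  rw [fullMap, LinearMap.comp_apply, ← hv]
  rfl

section

variable (hC : ∀ α, ⨅ j, W j ≤ C α) (hD : ∀ t, ⨅ j, W j ≤ D t)
  (x : ∀ s : Session N, CodeAlphabet W C D (.inl s))

theorem codeSymbol_edge_eq_zero (hDW : ∀ t, W t.elt ⊓ D t ≤ ⨅ j ∈ t.set.1, W j)
    (hWD : ∀ t, (⨅ j ∈ t.set.1, W j) ⊓ W t.elt ≤ D t) (e : Edge N)
    (h : ∀ f, AvailableAt (network N) (requirement N) (tail e) f → codeSymbol hC hD f x = 0) :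
    codeSymbol hC hD (.inr e) x = 0 := by
  obtain ⟨v, hv⟩ := Submodule.Quotient.mk_surjective _ (sourceMap W C D (full N) x)
  have hfull {U : Submodule F V} (hU : ⨅ j, W j ≤ U) := fullMap_eq_zero_iff hv.symm hU
  have zero_of_full (h0 : sourceMap W C D (full N) x = 0) {U : Submodule F V}
      (hU : ⨅ j, W j ≤ U) : fullMap C D U hU x = 0 := by
    rw [fullMap, LinearMap.comp_apply, h0, map_zero]
  cases e with
  | V j => exact zero_of_full (h (.inl (full N)) rfl) (iInf_le W j)
  | W₀ α => exact h (.inl α) rfl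
  | W₁ α => exact zero_of_full (h (.inl (full N)) rfl) (hC α)
  | W₁' α =>
    refine (hfull (iInf_le_biInf W α.1)).2 ((Submodule.mem_iInf _).2 fun j => (Submodule.mem_iInf _).2 fun hj => ?_)
    exact (hfull (iInf_le W j)).1 (h (.inr (.in₁ ⟨(α, j), hj⟩)) rfl)
  | in₁ p => exact h (.inr (.V p.1.2)) rfl
  | W₂ t =>
    have h1 : fullMap C D (⨅ j ∈ t.set.1, W j) (iInf_le_biInf W _) x = 0 :=
      h (.inr (.splitMix t)) rfl
    have h2 : sourceMap W C D t.set x = 0 := h (.inr (.sourceMix t)) rfl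
    exact (congrArg₂ (· + ·) h1 h2).trans (add_zero 0)
  | W₂' t => exact zero_of_full (h (.inl (full N)) rfl) (hC t.set)
  | W₂'' t =>
    have h1 := (hfull (iInf_le_biInf W _)).1 (h (.inr (.splitEncode t)) rfl)
    have h2 := (hfull (iInf_le W _)).1 (h (.inr (.sideEncode t)) rfl)
    exact (hfull (hD t)).2 (hWD t ⟨h1, h2⟩)
  | Wstar t =>
    have h1 := (hfull (hD t)).1 (h (.inr (.W₂'' t)) rfl)
    have h2 := (hfull (iInf_le W _)).1 (h (.inr (.sideDecode t)) rfl)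
    exact (hfull (iInf_le_biInf W t.set.1)).2 (hDW t ⟨h2, h1⟩)
  | Wstarstar t =>
    refine (hfull (iInf_le_biInf W t.set.1)).2 ((Submodule.mem_iInf _).2 fun j => (Submodule.mem_iInf _).2 fun hj => ?_)
    exact (hfull (iInf_le W j)).1 (h (.inr (.in₂ ⟨(t, j), hj⟩)) rfl)
  | in₂ p => exact h (.inr (.V p.1.2)) rfl
  | sideEncode t => exact h (.inr (.V t.elt)) rfl
  | sideDecode t => exact h (.inr (.V t.elt)) rfl
  | sourceMix t => exact h (.inl t.set) rfl
  | sourceUpper t => exact h (.inl t.set) rfl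
  | splitMix t => exact h (.inr (.Wstarstar t)) rfl
  | splitEncode t => exact h (.inr (.Wstarstar t)) rfl
  | forkUpper t => exact h (.inr (.W₂ t)) rfl
  | forkLower t => exact h (.inr (.W₂ t)) rfl

/-- The upper receiver removes `S_α` from `W` to find `V_α`, which `W'` completes to `S_N`; the
lower one removes `V_α`, known from `W*`, to find `S_α`. -/
theorem codeSymbol_source_eq_zero (hCW : ∀ α, (⨅ j ∈ α.1, W j) ⊓ C α ≤ ⨅ j, W j) (s : Session N)
    (p : Node N) (hp : demand p = some s)
    (h : ∀ f, AvailableAt (network N) (requirement N) p f → codeSymbol hC hD f x = 0) :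
    sourceMap W C D s x = 0 := by
  obtain ⟨v, hv⟩ := Submodule.Quotient.mk_surjective _ (sourceMap W C D (full N) x)
  have hfull {U : Submodule F V} (hU : ⨅ j, W j ≤ U) := fullMap_eq_zero_iff hv.symm hU
  have full_eq_zero (α : Session N) (h1 : v ∈ ⨅ j ∈ α.1, W j) (h2 : v ∈ C α) :
      sourceMap W C D (full N) x = 0 := by
    rw [← fullMap_full_eq]
    exact (hfull _).2 (iInf_le_biInf W _ (hCW α ⟨h1, h2⟩))
  cases p with
  | sink₀ α =>
    cases hp
    exact h (.inr (.W₀ s)) rfl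
  | sink₁ α =>
    cases hp
    exact full_eq_zero α ((hfull (iInf_le_biInf W _)).1 (h (.inr (.W₁' α)) rfl))
      ((hfull (hC α)).1 (h (.inr (.W₁ α)) rfl))
  | upper t =>
    cases hp
    have h1 := h (.inr (.forkUpper t)) rfl
    have h2 : sourceMap W C D t.set x = 0 := h (.inr (.sourceUpper t)) rfl
    have h3 : fullMap C D (⨅ j ∈ t.set.1, W j) (iInf_le_biInf W _) x +
      sourceMap W C D t.set x = 0 := h1
    rw [h2, add_zero] at h3
    exact full_eq_zero t.set ((hfull _).1 h3) ((hfull (hC _)).1 (h (.inr (.W₂' t)) rfl))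
  | lower t =>
    cases hp
    have h1 : fullMap C D (⨅ j ∈ t.set.1, W j) (iInf_le_biInf W _) x = 0 :=
      h (.inr (.Wstar t)) rfl
    have h3 : fullMap C D (⨅ j ∈ t.set.1, W j) (iInf_le_biInf W _) x +
      sourceMap W C D t.set x = 0 := h (.inr (.forkLower t)) rfl
    rwa [h1, zero_add] at h3
  | _ => cases hp

end

/-! ### Rates and capacities of the linear code -/

/-- Codisjointness is independence, so the entropies of `A` and `B` add up to that of `U`. -/
theorem logIndex_of_inf_eq_of_codisjoint [Finite V] {A B U : Submodule F V} (h : A ⊓ B = U)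
    (h' : Codisjoint A B) :
    B.toAddSubgroup.logIndex = U.toAddSubgroup.logIndex - A.toAddSubgroup.logIndex := by
  have h1 : A.toAddSubgroup ⊔ B.toAddSubgroup = ⊤ := by
    rw [← Submodule.sup_toAddSubgroup, h'.eq_top]
    rfl
  have h2 : A.toAddSubgroup ⊓ B.toAddSubgroup = U.toAddSubgroup := by
    rw [← h]
    rfl
  rw [← h2, AddSubgroup.logIndex_inf_of_sup_eq_top h1]
  ring

omit [NeZero N] in
theorem logIndex_codeSubspace_le [Finite V] {h : Finset (Fin N) → ℝ}
    {cap : Edge N → WithTop ℝ} (h_cap : IsInducedCapacity h cap)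
    (h_eq : ∀ α : Finset (Fin N), (⨅ j ∈ α, W j).toAddSubgroup.logIndex = h α)
    (h_C : ∀ α, (C α).toAddSubgroup.logIndex = h Finset.univ - h α.1)
    (h_D : ∀ t, (D t).toAddSubgroup.logIndex = h (insert t.elt t.set.1) - h {t.elt})
    (e : Edge N) :
    ((codeSubspace W C D (.inr e)).toAddSubgroup.logIndex : WithTop ℝ) ≤ cap e := by
  have h_single (i : Fin N) : (W i).toAddSubgroup.logIndex = h {i} := by
    rw [← h_eq]
    simp
  -- The values of `h` are entropies, hence nonnegative, so their sum bounds each of them; this is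
  -- what the distributing edges need.
  have le_sum (α : Finset (Fin N)) : h α ≤ ∑ β, h β :=
    Finset.single_le_sum (fun β _ => h_eq β ▸ AddSubgroup.logIndex_nonneg _) (Finset.mem_univ α)
  have le_cap {e : Edge N} {U : Submodule F V} {r r' : ℝ} (h1 : (r' : WithTop ℝ) ≤ cap e)
      (h2 : U.toAddSubgroup.logIndex = r) (h3 : r ≤ r') :
      (U.toAddSubgroup.logIndex : WithTop ℝ) ≤ cap e :=
    le_trans (WithTop.coe_le_coe.2 (h2.trans_le h3)) h1
  obtain ⟨cV, cW₀, cW₁, cW₁', cW₂, cW₂', cW₂'', cWs, cWss, cin₁, cin₂, crest⟩ := h_cap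
  cases e with
  | V j => exact le_cap (cV j).ge (h_single j) le_rfl
  | W₀ α => exact le_cap (cW₀ α).ge (h_eq _) le_rfl
  | W₁ α => exact le_cap (cW₁ α).ge (h_C _) le_rfl
  | W₁' α => exact le_cap (cW₁' α).ge (h_eq _) le_rfl
  | in₁ p => exact le_cap (cin₁ p) (h_single _) (le_sum _)
  | W₂ t => exact le_cap (cW₂ t).ge (h_eq _) le_rfl
  | W₂' t => exact le_cap (cW₂' t).ge (h_C _) le_rfl
  | W₂'' t => exact le_cap (cW₂'' t).ge (h_D t) le_rfl
  | Wstar t => exact le_cap (cWs t).ge (h_eq _) le_rfl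
  | Wstarstar t => exact le_cap (cWss t) (h_eq _) le_rfl
  | in₂ p => exact le_cap (cin₂ p) (h_single _) (le_sum _)
  | sideEncode t => exact le_cap (crest t _ (by simp)) (h_single _) (le_sum _)
  | sideDecode t => exact le_cap (crest t _ (by simp)) (h_single _) (le_sum _)
  | _ t => exact le_cap (crest t _ (by simp)) (h_eq _) (le_sum _)

theorem exists_code [Finite V] (hC : ∀ α, (⨅ j ∈ α.1, W j) ⊓ C α = ⨅ j, W j)
    (hD : ∀ t, W t.elt ⊓ D t = ⨅ j ∈ insert t.elt t.set.1, W j) :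
    ∃ c : NetworkCode.{u} (network N) (requirement N), c.IsLinear F ∧ c.ZeroError ∧
      ∀ f, Nat.card (c.alphabet f) = Nat.card (CodeAlphabet W C D f) := by
  have hWC (α) : ⨅ j, W j ≤ C α := (hC α).symm.le.trans inf_le_right
  have hWD (t) : ⨅ j, W j ≤ D t :=
    ((iInf_le_biInf W _).trans (hD t).symm.le).trans inf_le_right
  have hD₁ (t) : W t.elt ⊓ D t ≤ ⨅ j ∈ t.set.1, W j := by
    rw [hD, Finset.iInf_insert]
    exact inf_le_right
  have hD₂ (t) : (⨅ j ∈ t.set.1, W j) ⊓ W t.elt ≤ D t := by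
    rw [inf_comm, ← Finset.iInf_insert, ← hD]
    exact inf_le_right
  have : ∀ f, Finite (CodeAlphabet W C D f) := fun _ =>
    Finite.of_surjective _ (Submodule.Quotient.mk_surjective _)
  exact NetworkCode.exists_isLinear_zeroError (network N) (requirement N)
    F (CodeAlphabet W C D) (codeSymbol hWC hWD) (fun _ _ => rfl)
    (fun e x h => codeSymbol_edge_eq_zero hWC hWD x hD₁ hD₂ e h)
    (fun s p hp x h => codeSymbol_source_eq_zero hWC hWD x (fun α => (hC α).le) s p hp h)

theorem admissible_of_linearGroupCharacterizable {h : Finset (Fin N) → ℝ}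
    {cap : Edge N → WithTop ℝ} (h_cap : IsInducedCapacity h cap)
    (hh : LinearGroupCharacterizable F h) :
    AdmissibleBy (net := network N) (M := requirement N) (NetworkCode.IsLinear F) (rate h) cap := by
  obtain ⟨V, _, _, _, W, hW⟩ := hh
  have h_eq (α : Finset (Fin N)) : (⨅ j ∈ α, W j).toAddSubgroup.logIndex = h α := by
    rw [hW, entropyFunction_cosetLaw]
    congr 1
    ext v
    simp [AddSubgroup.mem_iInf, Submodule.mem_iInf]
  -- `C α` holds exactly the information that `V_α` lacks about `S_N`, independently of `V_α`.
  have hC (α : Session N) := IsModularLattice.exists_inf_eq_and_codisjoint (iInf_le_biInf W α.1)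
  choose C hC hC' using hC
  -- `D t` supplements `V_i` to the pair `(V_α, V_i)` with nothing redundant, so `W''` meets its
  -- capacity `h(α ∪ i) - h(i)` with equality.
  have hD (t : Pair N) := IsModularLattice.exists_inf_eq_and_codisjoint
    (show ⨅ j ∈ insert t.elt t.set.1, W j ≤ W t.elt from
      iInf₂_le _ (Finset.mem_insert_self _ _))
  choose D hD hD' using hD
  have h_C (α) : (C α).toAddSubgroup.logIndex = h Finset.univ - h α.1 := by
    rw [logIndex_of_inf_eq_of_codisjoint (hC α) (hC' α), h_eq, ← h_eq Finset.univ]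
    simp
  have h_D (t) : (D t).toAddSubgroup.logIndex = h (insert t.elt t.set.1) - h {t.elt} := by
    rw [logIndex_of_inf_eq_of_codisjoint (hD t) (hD' t), h_eq, ← h_eq {t.elt}]
    simp
  obtain ⟨c, hlin, hc, hcard⟩ := exists_code hC hD
  have hlog (f) : Real.logb 2 (Nat.card (c.alphabet f)) =
      (codeSubspace W C D f).toAddSubgroup.logIndex :=
    congrArg (fun n : ℕ => Real.logb 2 n) (hcard f)
  have hcap (e) : ((Real.logb 2 (Nat.card (c.alphabet (.inr e))) : ℝ) : WithTop ℝ) ≤ cap e :=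
    (congrArg WithTop.some (hlog (.inr e))).trans_le
      (logIndex_codeSubspace_le h_cap h_eq h_C h_D e)
  have hrate (s : Session N) : rate h s ≤ Real.logb 2 (Nat.card (c.alphabet (.inl s))) :=
    ((hlog (.inl s)).trans (h_eq s.1)).ge
  exact ⟨c, hlin, hc, hcap, hrate⟩

end Dagger

theorem theorem3 (F : Type u) [Field F] [Finite F] (N : ℕ) [NeZero N]
    (h : Finset (Fin N) → ℝ) (h_empty : h ∅ = 0)
    (cap : Dagger.Edge N → WithTop ℝ) (h_cap : Dagger.IsInducedCapacity h cap) :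
    (AdmissibleBy (net := Dagger.network N) (M := Dagger.requirement N)
        (NetworkCode.IsLinear F) (Dagger.rate h) cap ↔
      LinearGroupCharacterizable F h) ∧
    (AdmissibleBy (net := Dagger.network N) (M := Dagger.requirement N)
        NetworkCode.IsAbelianGroupCode.{u} (Dagger.rate h) cap →
      AbelianGroupCharacterizable.{u} h) :=
  ⟨⟨Dagger.linearGroupCharacterizable_of_admissible F h_empty h_cap,
    Dagger.admissible_of_linearGroupCharacterizable h_cap⟩,
    Dagger.abelianGroupCharacterizable_of_admissible h_empty h_cap⟩
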